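/- Let $n\ge 1$ and let $\Omega=D_1\times\cdots\times D_n\subset\mathbb C^n$, where each $D_j\subset\mathbb C$ is a bounded domain (nonempty, open, connected). Let $0<\alpha_j<2$ for $j=1,\dots,n$ and $1<p<\infty$. For a measurable weight $\mu:\mathbb C^n\to[0,\infty)$ that is not almost everywhere zero, put $$A_p^*(\mu)=\sup\Big(\frac1{|D|}\int_D\mu(z)\,dV_{z_j}\Big)\Big(\frac1{|D|}\int_D\mu(z)^{\frac1{1-p}}\,dV_{z_j}\Big)^{p-1},$$ where the supremum is taken over $j=1,\dots,n$, almost every $(z_1,\dots,z_{j-1},z_{j+1},\dots,z_n)\in\mathbb C^{n-1}$ and all discs $D\subset\mathbb C$ (an essential supremum in the frozen variables), with values in $[0,\infty]$ and the conventions $0^{1/(1-p)}=\infty$, $0\cdot\infty=0$. Write $\mu\in A_p^*$ if $A_p^*(\mu)<\infty$, and let $L^p(\Omega,\mu)$ be the space of measurable functions $f:\Omega\to\mathbb C$ with $$\|f\|_{L^p(\Omega,\mu)}=\Big(\int_\Omega|f(z)|^p\mu(z)\,dV_z\Big)^{1/p}<\infty .$$ Then for every $\mu\in A_p^*$ the Riesz-type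 integral $$R_\alpha f(z)=\int_\Omega\frac{f(\zeta)}{\prod_{j=1}^n|\zeta_j-z_j|^{\alpha_j}}\,dV_\zeta$$ defines a bounded operator from $L^p(\Omega,\mu)$ into itself: for every $f\in L^p(\Omega,\mu)$ the integral converges absolutely for almost every $z\in\Omega$, $R_\alpha f\in L^p(\Omega,\mu)$, and $$\|R_\alpha f\|_{L^p(\Omega,\mu)}\le C\,\|f\|_{L^p(\Omega,\mu)} .$$ Here the constant $C$ depends only on $\Omega$, $\alpha$, $p$ and an upper bound for $A_p^*(\mu)$. -/

import Mathlib

open MeasureTheory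
open scoped NNReal ENNReal

noncomputable section

/-- The Muckenhoupt quantity of a one-variable weight `v` on the disc of centre `c` and radius `r`:
`(⨍_D v) * (⨍_D v ^ (1 / (1 - p))) ^ (p - 1)`, computed in `[0, ∞]`
(so `v ^ (1 / (1 - p)) = ∞` where `v = 0`). -/
def discApQuantity (p : ℝ) (v : ℂ → ℝ≥0) (c : ℂ) (r : ℝ) : ℝ≥0∞ :=
  (⨍⁻ w in Metric.ball c r, (v w : ℝ≥0∞) ∂volume) *
    (⨍⁻ w in Metric.ball c r, (v w : ℝ≥0∞) ^ (1 / (1 - p)) ∂volume) ^ (p - 1)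

/-- The one-variable slice of `μ` in the `j`-th variable, the other variables being frozen
at `zhat`. -/
def weightSlice {n : ℕ} (μ : (Fin (n + 1) → ℂ) → ℝ≥0) (j : Fin (n + 1)) (zhat : Fin n → ℂ) :
    ℂ → ℝ≥0 :=
  fun w => μ (Fin.insertNth (α := fun _ => ℂ) j w zhat)

/-- The `A_p^*` constant of a weight on `ℂ^(n+1)`: the supremum over all coordinates `j`, almost
every `zhat` in `ℂ^n` and all discs in `ℂ`. -/
def apStarConst {n : ℕ} (p : ℝ) (μ : (Fin (n + 1) → ℂ) → ℝ≥0) : ℝ≥0∞ :=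
  ⨆ j : Fin (n + 1),
    essSup (fun zhat : Fin n → ℂ =>
      ⨆ (c : ℂ) (r : ℝ) (_ : 0 < r), discApQuantity p (weightSlice μ j zhat) c r) volume

/-- The class `A_p^*`: Lebesgue measurable weights with finite `A_p^*` constant. In `[0, ∞]` the
product `0 * ∞` is `0`, so the weight that vanishes almost everywhere has to be excluded. -/
structure MemApStar {n : ℕ} (p : ℝ) (μ : (Fin (n + 1) → ℂ) → ℝ≥0) : Prop where
  aemeasurable : AEMeasurable μ volume
  not_ae_zero : ¬ (μ =ᵐ[volume] 0)
  const_lt_top : apStarConst p μ < ∞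

/-- The measure `μ dV` on `Ω`; thus `L^p(Ω, μ)` is the `L^p` space of `weightedVolume Ω μ`. -/
def weightedVolume {n : ℕ} (Ω : Set (Fin n → ℂ)) (μ : (Fin n → ℂ) → ℝ≥0) :
    Measure (Fin n → ℂ) :=
  (volume.restrict Ω).withDensity (fun z => (μ z : ℝ≥0∞))

/-- The integrand `f(ζ) / ∏_j |ζ_j - z_j| ^ α_j` of the Riesz-type integral. -/
def rieszIntegrand {n : ℕ} (α : Fin n → ℝ) (f : (Fin n → ℂ) → ℂ) (z ζ : Fin n → ℂ) : ℂ :=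
  f ζ / ((∏ j, ‖ζ j - z j‖ ^ α j : ℝ) : ℂ)

/-- The Riesz-type integral `R_α f(z)` over `Ω`. -/
def rieszIntegral {n : ℕ} (Ω : Set (Fin n → ℂ)) (α : Fin n → ℝ) (f : (Fin n → ℂ) → ℂ)
    (z : Fin n → ℂ) : ℂ :=
  ∫ ζ in Ω, rieszIntegrand α f z ζ

end

/-! The kernel is positive and a product over the variables. With `f` replaced by its absolute
value, the operator is therefore dominated by one-variable potentials applied in turn. Each is
bounded on the weighted space by freezing the other variables: almost every slice of `μ` is a
one-variable weight with `A_p` constant at most `K`.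

Since `Ω` is bounded, the kernel `|w|^{-a}` matters only for `|w| < R` and lies below a sum over `m`
of `(R/2^(m+1))^(-a)` times the indicator of the disc of radius `R/2^m`. Averaging over discs of a
fixed radius is bounded on `L^p(v)` uniformly in the radius, by Hölder, Tonelli and the `A_p`
condition on the disc of twice the radius; no maximal function is needed. The dyadic masses decay
like `(2^a/4)^m`, summable because `a < 2`. Jensen then gives the constant `S^p * K` in each
variable, where `S` is the total mass.

Hölder, and the passage between weighted and Lebesgue null sets, require `μ > 0` almost everywhere.
A one-variable `A_p` weight vanishes almost everywhere or almost nowhere, so almost every slice of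
the zero set of `μ` is null or conull. Such a set is invariant, up to null sets, under coordinate
translations, hence under all translations, hence is null or conull; conull is excluded by
hypothesis. -/

/-! ### Hölder and Jensen inequalities; the `A_p` condition without averages -/

/-- Weighted Hölder inequality: `(∫ g)^p ≤ (∫ g^p v) (∫ v^{1/(1-p)})^{p-1}` for a positive `v`. -/
theorem lintegral_rpow_le_lintegral_mul_lintegral {X : Type*} [MeasurableSpace X] (m : Measure X)
    {p : ℝ} (hp : 1 < p) {v : X → ℝ≥0} (hv : Measurable v) (hv0 : ∀ᵐ x ∂m, v x ≠ 0)
    {g : X → ℝ≥0∞} (hg : Measurable g) :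
    (∫⁻ x, g x ∂m) ^ p ≤ (∫⁻ x, g x ^ p * v x ∂m) *
      (∫⁻ x, (v x : ℝ≥0∞) ^ (1 / (1 - p)) ∂m) ^ (p - 1) := by
  have hp0 : 0 < p := by linarith
  have hp1 : 0 < p - 1 := by linarith
  have hpq := Real.HolderConjugate.conjExponent hp
  -- Hölder for the splitting `g = (g * v^(1/p)) * v^(-1/p)`, valid where `v ≠ 0`.
  have h := ENNReal.lintegral_mul_le_Lp_mul_Lq m hpq
    (f := fun x => g x * (v x : ℝ≥0∞) ^ (1 / p)) (g := fun x => (v x : ℝ≥0∞) ^ (-(1 / p)))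
    (by fun_prop) (by fun_prop)
  have e1 : ∫⁻ x, ((fun x => g x * (v x : ℝ≥0∞) ^ (1 / p)) *
      fun x => (v x : ℝ≥0∞) ^ (-(1 / p))) x ∂m = ∫⁻ x, g x ∂m := by
    refine lintegral_congr_ae ?_
    filter_upwards [hv0] with x hx
    simp only [Pi.mul_apply]
    rw [mul_assoc, ← ENNReal.rpow_add _ _ (by exact_mod_cast hx) ENNReal.coe_ne_top]
    simp
  have e2 : ∀ x, (g x * (v x : ℝ≥0∞) ^ (1 / p)) ^ p = g x ^ p * v x := by
    intro x
    rw [ENNReal.mul_rpow_of_nonneg _ _ hp0.le, ← ENNReal.rpow_mul, one_div_mul_cancel hp0.ne',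
      ENNReal.rpow_one]
  have e3 : ∀ x, ((v x : ℝ≥0∞) ^ (-(1 / p))) ^ (Real.conjExponent p)
      = (v x : ℝ≥0∞) ^ (1 / (1 - p)) := by
    intro x
    rw [← ENNReal.rpow_mul]
    congr 1
    have : 1 - p ≠ 0 := by linarith
    rw [Real.conjExponent]
    field_simp
    ring
  rw [e1] at h
  simp only [e2, e3] at h
  calc (∫⁻ x, g x ∂m) ^ p ≤ _ := ENNReal.rpow_le_rpow h hp0.le
    _ = _ := by
      rw [ENNReal.mul_rpow_of_nonneg _ _ hp0.le, ← ENNReal.rpow_mul, one_div_mul_cancel hp0.ne',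
        ENNReal.rpow_one, ← ENNReal.rpow_mul]
      congr 2
      rw [Real.conjExponent]
      field_simp

/-- Jensen's inequality for weighted series in `[0, ∞]`. -/
theorem tsum_mul_rpow_le {p : ℝ} (hp : 1 < p) {s : ℕ → ℝ≥0} (hs : ∀ m, s m ≠ 0)
    (y : ℕ → ℝ≥0∞) :
    (∑' m, (s m : ℝ≥0∞) * y m) ^ p ≤
      (∑' m, (s m : ℝ≥0∞)) ^ (p - 1) * ∑' m, (s m : ℝ≥0∞) * y m ^ p := by
  -- The weight `s^(1-p)` is chosen so that its power `1/(1-p)` is `s` and `(s*y)^p * s^(1-p) = s *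
  -- y^p`.
  have h := lintegral_rpow_le_lintegral_mul_lintegral Measure.count hp
    (v := fun m => s m ^ (1 - p)) (g := fun m => (s m : ℝ≥0∞) * y m)
    (measurable_of_countable _) (Filter.Eventually.of_forall fun m => by simp [hs m])
    (measurable_of_countable _)
  simp only [lintegral_count] at h
  have hc : ∀ m, ((s m ^ (1 - p) : ℝ≥0) : ℝ≥0∞) = (s m : ℝ≥0∞) ^ (1 - p) := fun m =>
    (ENNReal.coe_rpow_of_ne_zero (hs m) _)
  have e1 : ∀ m, ((s m : ℝ≥0∞) * y m) ^ p * ((s m ^ (1 - p) : ℝ≥0) : ℝ≥0∞)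
      = s m * y m ^ p := by
    intro m
    rw [hc, ENNReal.mul_rpow_of_nonneg _ _ (by linarith), mul_right_comm,
      ← ENNReal.rpow_add _ _ (by exact_mod_cast hs m) ENNReal.coe_ne_top]
    simp
  have e2 : ∀ m, ((s m ^ (1 - p) : ℝ≥0) : ℝ≥0∞) ^ (1 / (1 - p)) = s m := by
    intro m
    have : 1 - p ≠ 0 := by linarith
    rw [hc, ← ENNReal.rpow_mul, mul_one_div_cancel this, ENNReal.rpow_one]
  simp only [e1, e2] at h
  rwa [mul_comm] at h

theorem setLIntegral_mul_rpow_le_of_discApQuantity_le {p : ℝ} (hp : 1 < p) {v : ℂ → ℝ≥0}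
    {K : ℝ≥0∞} {c : ℂ} {r : ℝ} (hr : 0 < r) (h : discApQuantity p v c r ≤ K) :
    (∫⁻ w in Metric.ball c r, (v w : ℝ≥0∞)) *
      (∫⁻ w in Metric.ball c r, (v w : ℝ≥0∞) ^ (1 / (1 - p))) ^ (p - 1) ≤
      K * volume (Metric.ball c r) ^ p := by
  have hV0 : volume (Metric.ball c r) ≠ 0 := (Metric.measure_ball_pos _ _ hr).ne'
  have hVt : volume (Metric.ball c r) ≠ ∞ := measure_ball_lt_top.ne
  unfold discApQuantity at h
  rw [setLAverage_eq, setLAverage_eq, ENNReal.div_rpow_of_nonneg _ _ (by linarith)] at h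
  set V := volume (Metric.ball c r)
  have hVp : V ^ p = V * V ^ (p - 1) := by
    conv_rhs => rw [← ENNReal.rpow_one V, ← ENNReal.rpow_mul, ← ENNReal.rpow_add _ _ hV0 hVt]
    congr 1; ring
  have hV1 : V ^ (p - 1) ≠ 0 := by simp [ENNReal.rpow_eq_zero_iff, hV0, hVt]
  have hV2 : V ^ (p - 1) ≠ ∞ := by simp [ENNReal.rpow_eq_top_iff, hV0, hVt]
  calc _ = (∫⁻ w in Metric.ball c r, (v w : ℝ≥0∞)) / V * V *
        ((∫⁻ w in Metric.ball c r, (v w : ℝ≥0∞) ^ (1 / (1 - p))) ^ (p - 1) / V ^ (p - 1) *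
          V ^ (p - 1)) := by
        rw [ENNReal.div_mul_cancel hV0 hVt, ENNReal.div_mul_cancel hV1 hV2]
    _ = (∫⁻ w in Metric.ball c r, (v w : ℝ≥0∞)) / V *
        ((∫⁻ w in Metric.ball c r, (v w : ℝ≥0∞) ^ (1 / (1 - p))) ^ (p - 1) / V ^ (p - 1)) *
          V ^ p := by rw [hVp]; ring
    _ ≤ K * V ^ p := by gcongr

/-! ### Averages over discs of a fixed radius -/

theorem measurable_setLIntegral_ball (r : ℝ) {g : ℂ → ℝ≥0∞} (hg : Measurable g) :
    Measurable fun z => ∫⁻ w in Metric.ball z r, g w := by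
  have : Measurable fun q : ℂ × ℂ => Set.indicator {q : ℂ × ℂ | dist q.2 q.1 < r}
      (fun q => g q.2) q :=
    (hg.comp measurable_snd).indicator
      (measurableSet_lt (measurable_snd.dist measurable_fst) measurable_const)
  have h2 := this.lintegral_prod_right' (ν := volume)
  convert h2 using 2 with z
  rw [← lintegral_indicator Metric.isOpen_ball.measurableSet]
  rfl

/-- Tonelli's theorem for the averaging kernel `1_{|z-w|<r}`. -/
theorem lintegral_setLIntegral_ball_mul (r : ℝ) {g u : ℂ → ℝ≥0∞} (hg : Measurable g)
    (hu : Measurable u) :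
    ∫⁻ z, (∫⁻ w in Metric.ball z r, g w) * u z = ∫⁻ w, g w * ∫⁻ z in Metric.ball w r, u z := by
  have hS : MeasurableSet {q : ℂ × ℂ | dist q.2 q.1 < r} :=
    measurableSet_lt (measurable_snd.dist measurable_fst) measurable_const
  have key := lintegral_lintegral_swap (μ := (volume : Measure ℂ)) (ν := (volume : Measure ℂ))
    (f := fun z w => Set.indicator {q : ℂ × ℂ | dist q.2 q.1 < r} (fun q => g q.2 * u q.1) (z, w))
    (((hg.comp measurable_snd).mul (hu.comp measurable_fst)).indicator hS).aemeasurable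
  convert key using 2
  · ext z
    rw [← lintegral_mul_const _ hg, ← lintegral_indicator Metric.isOpen_ball.measurableSet]
    rfl
  · ext w
    rw [← lintegral_const_mul _ hu, ← lintegral_indicator Metric.isOpen_ball.measurableSet]
    refine lintegral_congr fun z => ?_
    simp only [Set.indicator, Metric.mem_ball, Set.mem_ofPred_eq, dist_comm]

/-- Averaging over discs of a fixed radius is bounded on `L^p(v)` for `v` in `A_p`. -/
theorem lintegral_setLIntegral_ball_rpow_le {p : ℝ} (hp : 1 < p) {v : ℂ → ℝ≥0}
    (hv : Measurable v) (hv0 : ∀ᵐ x, v x ≠ 0) {K : ℝ≥0∞}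
    (hK : ∀ c r, 0 < r → discApQuantity p v c r ≤ K) {r : ℝ} (hr : 0 < r)
    {g : ℂ → ℝ≥0∞} (hg : Measurable g) :
    ∫⁻ z, (∫⁻ w in Metric.ball z r, g w) ^ p * v z ≤
      K * volume (Metric.ball (0 : ℂ) (2 * r)) ^ p * ∫⁻ w, g w ^ p * v w := by
  have hp1 : 0 ≤ p - 1 := by linarith
  have hσ : Measurable fun w => (v w : ℝ≥0∞) ^ (1 / (1 - p)) := by fun_prop
  calc ∫⁻ z, (∫⁻ w in Metric.ball z r, g w) ^ p * v z
      ≤ ∫⁻ z, (∫⁻ w in Metric.ball z r, g w ^ p * v w) *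
          ((∫⁻ w in Metric.ball z r, (v w : ℝ≥0∞) ^ (1 / (1 - p))) ^ (p - 1) * v z) := by
        refine lintegral_mono fun z => ?_
        rw [← mul_assoc]
        gcongr
        exact lintegral_rpow_le_lintegral_mul_lintegral _ hp hv (ae_restrict_of_ae hv0) hg
    _ = ∫⁻ w, g w ^ p * v w * ∫⁻ z in Metric.ball w r,
          (∫⁻ w in Metric.ball z r, (v w : ℝ≥0∞) ^ (1 / (1 - p))) ^ (p - 1) * v z :=
        lintegral_setLIntegral_ball_mul r (by fun_prop)
          (((measurable_setLIntegral_ball r hσ).pow_const _).mul hv.coe_nnreal_ennreal)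
    _ ≤ ∫⁻ w, g w ^ p * v w * (K * volume (Metric.ball (0 : ℂ) (2 * r)) ^ p) := by
        refine lintegral_mono fun w => ?_
        gcongr
        calc ∫⁻ z in Metric.ball w r,
              (∫⁻ w in Metric.ball z r, (v w : ℝ≥0∞) ^ (1 / (1 - p))) ^ (p - 1) * v z
            ≤ ∫⁻ z in Metric.ball w r,
              (∫⁻ w in Metric.ball w (2 * r), (v w : ℝ≥0∞) ^ (1 / (1 - p))) ^ (p - 1) * v z := by
              -- For `|z - w| < r` the disc at `z` lies in the disc of radius `2r` at `w`. The inner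
              -- factor thereby becomes independent of `z`, and both factors of the `A_p` quantity
              -- can be taken over the same doubled disc.
              refine setLIntegral_mono_ae (by fun_prop) (Filter.Eventually.of_forall fun z hz => ?_)
              gcongr
              exact Metric.ball_subset_ball' (by have := Metric.mem_ball.1 hz; linarith)
          _ = (∫⁻ z in Metric.ball w r, (v z : ℝ≥0∞)) *
              (∫⁻ w in Metric.ball w (2 * r), (v w : ℝ≥0∞) ^ (1 / (1 - p))) ^ (p - 1) := by
              rw [lintegral_const_mul _ (by fun_prop), mul_comm]
          _ ≤ (∫⁻ z in Metric.ball w (2 * r), (v z : ℝ≥0∞)) *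
              (∫⁻ w in Metric.ball w (2 * r), (v w : ℝ≥0∞) ^ (1 / (1 - p))) ^ (p - 1) := by
              gcongr
              linarith
          _ ≤ K * volume (Metric.ball w (2 * r)) ^ p :=
              setLIntegral_mul_rpow_le_of_discApQuantity_le hp (by linarith)
                (hK _ _ (by linarith))
          _ = K * volume (Metric.ball (0 : ℂ) (2 * r)) ^ p := by
              rw [Measure.addHaar_ball_center]
    _ = _ := by rw [lintegral_mul_const _ (by fun_prop), mul_comm]

/-! ### The one-variable Riesz potential -/

/-- A dyadic majorant of the truncated Riesz kernel `1_{|w|<R} |w|^{-a}`. -/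
noncomputable def dyadicRieszKernel (a R : ℝ) (w : ℂ) : ℝ≥0∞ :=
  ∑' m : ℕ, ENNReal.ofReal ((R / 2 ^ (m + 1)) ^ (-a)) *
    (Metric.ball (0 : ℂ) (R / 2 ^ m)).indicator 1 w

/-- The mass of the `m`-th dyadic piece, up to the doubling of the radius. -/
noncomputable def dyadicRieszMass (a R : ℝ) (m : ℕ) : ℝ≥0 :=
  ((R / 2 ^ (m + 1)) ^ (-a)).toNNReal * (volume (Metric.ball (0 : ℂ) (2 * (R / 2 ^ m)))).toNNReal

theorem measurable_dyadicRieszKernel (a R : ℝ) : Measurable (dyadicRieszKernel a R) :=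
  Measurable.tsum fun _ =>
    (measurable_one.indicator Metric.isOpen_ball.measurableSet).const_mul _

/-- A single term suffices: the one whose dyadic annulus contains `w`. At `w = 0` the left side is
`0`, by the convention for negative powers of `0`. -/
theorem rpow_neg_le_dyadicRieszKernel {a R : ℝ} (ha : 0 < a) {w : ℂ} (hw : ‖w‖ < R) :
    ENNReal.ofReal (‖w‖ ^ (-a)) ≤ dyadicRieszKernel a R w := by
  rcases eq_or_ne w 0 with rfl | hw0
  · simp [Real.zero_rpow (neg_ne_zero.2 ha.ne')]
  have hw1 : 0 < ‖w‖ := norm_pos_iff.2 hw0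
  have hR : 0 < R := hw1.trans hw
  obtain ⟨m, h1, h2⟩ := exists_nat_pow_near_of_lt_one (x := ‖w‖ / R) (y := (1 / 2 : ℝ))
    (by positivity) ((div_le_one hR).2 hw.le) (by norm_num) (by norm_num)
  have e : ∀ k : ℕ, R / 2 ^ k = (1 / 2 : ℝ) ^ k * R := fun k => by
    rw [one_div, inv_pow, div_eq_mul_inv, mul_comm]
  -- The annuli obtained above are closed on the outside, whereas the discs are open. A point on an
  -- outer boundary is moved to the next larger annulus, which exists because `‖w‖ < R`.
  obtain ⟨m, h1, h2⟩ : ∃ m : ℕ, R / 2 ^ (m + 1) ≤ ‖w‖ ∧ ‖w‖ < R / 2 ^ m := by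
    rcases h2.lt_or_eq with h3 | h3
    · exact ⟨m, by rw [e]; exact ((lt_div_iff₀ hR).1 h1).le, by rw [e]; exact (div_lt_iff₀ hR).1 h3⟩
    · cases m with
      | zero =>
        rw [pow_zero, div_eq_one_iff_eq hR.ne'] at h3
        exact absurd h3 hw.ne
      | succ m =>
        have h4 := (div_eq_iff hR.ne').1 h3
        refine ⟨m, by rw [e, h4], ?_⟩
        rw [h4, e]
        have : (1 / 2 : ℝ) ^ (m + 1) < (1 / 2) ^ m :=
          pow_lt_pow_right_of_lt_one₀ (by norm_num) (by norm_num) (Nat.lt_succ_self m)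
        gcongr
  refine le_trans ?_ (ENNReal.le_tsum m)
  rw [Set.indicator_of_mem (by simpa using h2), Pi.one_apply, mul_one]
  exact ENNReal.ofReal_le_ofReal (Real.rpow_le_rpow_of_nonpos (by positivity) h1 (by linarith))

theorem dyadicRieszMass_ne_zero (a : ℝ) {R : ℝ} (hR : 0 < R) (m : ℕ) :
    dyadicRieszMass a R m ≠ 0 := by
  refine mul_ne_zero ?_ ?_
  · simp only [ne_eq, Real.toNNReal_eq_zero, not_le]
    positivity
  · rw [ne_eq, ENNReal.toNNReal_eq_zero_iff, not_or]
    exact ⟨(Metric.measure_ball_pos _ _ (by positivity)).ne', measure_ball_lt_top.ne⟩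

theorem coe_dyadicRieszMass (a R : ℝ) (m : ℕ) : (dyadicRieszMass a R m : ℝ≥0∞) =
    ENNReal.ofReal ((R / 2 ^ (m + 1)) ^ (-a)) *
      volume (Metric.ball (0 : ℂ) (2 * (R / 2 ^ m))) := by
  rw [dyadicRieszMass, ENNReal.coe_mul, ENNReal.coe_toNNReal measure_ball_lt_top.ne]
  rfl

theorem tsum_dyadicRieszMass_ne_top {a R : ℝ} (ha : a < 2) (hR : 0 < R) :
    ∑' m, (dyadicRieszMass a R m : ℝ≥0∞) ≠ ∞ := by
  rw [ENNReal.tsum_coe_ne_top_iff_summable, ← NNReal.summable_coe]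
  -- Halving the radius multiplies the kernel bound by `2^a` and the area by `1/4`; this is where `a
  -- < 2` enters.
  have hq : (2 : ℝ) ^ a / 4 < 1 := by
    rw [div_lt_one (by norm_num)]
    calc (2 : ℝ) ^ a < 2 ^ (2 : ℝ) := Real.rpow_lt_rpow_of_exponent_lt (by norm_num) ha
      _ = 4 := by norm_num
  have := (summable_geometric_of_lt_one (r := (2 : ℝ) ^ a / 4) (by positivity) hq).mul_left
    (R ^ (-a) * 2 ^ a * (4 * R ^ 2 * Real.pi))
  refine this.congr fun m => ?_
  rw [dyadicRieszMass, NNReal.coe_mul, Real.coe_toNNReal _ (by positivity), Complex.volume_ball]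
  have e1 : (R / 2 ^ (m + 1)) ^ (-a) = R ^ (-a) * (2 ^ a * (2 ^ a) ^ m) := by
    rw [Real.div_rpow hR.le (by positivity), Real.rpow_neg (x := 2 ^ (m + 1)) (by positivity),
      div_inv_eq_mul, ← Real.rpow_natCast 2 (m + 1), ← Real.rpow_mul (by norm_num),
      mul_comm _ a, Real.rpow_mul (by norm_num), Real.rpow_natCast, pow_succ']
  have hn : (0 : ℝ) ≤ 2 * (R / 2 ^ m) := by positivity
  have e2 : (((ENNReal.ofReal (2 * (R / 2 ^ m)) ^ 2 * (NNReal.pi : ℝ≥0∞)).toNNReal : ℝ≥0) : ℝ)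
      = 4 * R ^ 2 * Real.pi / 4 ^ m := by
    rw [ENNReal.coe_toNNReal_eq_toReal, ENNReal.toReal_mul, ENNReal.toReal_pow,
      ENNReal.toReal_ofReal hn]
    simp only [ENNReal.coe_toReal, NNReal.coe_real_pi]
    rw [show (4 : ℝ) = 2 ^ 2 by norm_num, ← pow_mul]
    field_simp
    ring
  rw [e1, e2, div_pow]
  ring

theorem lintegral_dyadicRieszKernel_mul (a R : ℝ) {g : ℂ → ℝ≥0∞} (hg : Measurable g) (z : ℂ) :
    ∫⁻ w, dyadicRieszKernel a R (w - z) * g w =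
      ∑' m : ℕ, ENNReal.ofReal ((R / 2 ^ (m + 1)) ^ (-a)) *
        ∫⁻ w in Metric.ball z (R / 2 ^ m), g w := by
  have h1 : ∀ w, dyadicRieszKernel a R (w - z) * g w =
      ∑' m : ℕ, ENNReal.ofReal ((R / 2 ^ (m + 1)) ^ (-a)) *
        (Metric.ball z (R / 2 ^ m)).indicator g w := by
    intro w
    rw [dyadicRieszKernel, ← ENNReal.tsum_mul_right]
    refine tsum_congr fun m => ?_
    rw [mul_assoc]
    congr 1
    simp only [Set.indicator, Metric.mem_ball, dist_eq_norm, sub_zero, Pi.one_apply]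
    split_ifs <;> simp
  simp_rw [h1]
  rw [lintegral_tsum fun m =>
    ((hg.indicator Metric.isOpen_ball.measurableSet).const_mul _).aemeasurable]
  refine tsum_congr fun m => ?_
  rw [lintegral_const_mul _ (hg.indicator Metric.isOpen_ball.measurableSet),
    lintegral_indicator Metric.isOpen_ball.measurableSet]

/-- The one-variable weighted bound for the (dyadic, truncated) Riesz potential. -/
theorem lintegral_dyadicRieszKernel_rpow_le {p : ℝ} (hp : 1 < p) {v : ℂ → ℝ≥0}
    (hv : Measurable v) (hv0 : ∀ᵐ x, v x ≠ 0) {K : ℝ≥0∞}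
    (hK : ∀ c r, 0 < r → discApQuantity p v c r ≤ K) (a : ℝ) {R : ℝ} (hR : 0 < R)
    {g : ℂ → ℝ≥0∞} (hg : Measurable g) :
    ∫⁻ z, (∫⁻ w, dyadicRieszKernel a R (w - z) * g w) ^ p * v z ≤
      (∑' m, (dyadicRieszMass a R m : ℝ≥0∞)) ^ p * K * ∫⁻ w, g w ^ p * v w := by
  have hp0 : 0 ≤ p := by linarith
  set S := ∑' m, (dyadicRieszMass a R m : ℝ≥0∞) with hS
  let V : ℕ → ℝ≥0∞ := fun m => volume (Metric.ball (0 : ℂ) (2 * (R / 2 ^ m)))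
  have hV0 : ∀ m, V m ≠ 0 := fun m => (Metric.measure_ball_pos _ _ (by positivity)).ne'
  have hVt : ∀ m, V m ≠ ∞ := fun m => measure_ball_lt_top.ne
  have hA := fun m : ℕ => measurable_setLIntegral_ball (R / 2 ^ m) hg
  have hpt : ∀ z, (∫⁻ w, dyadicRieszKernel a R (w - z) * g w) ^ p * v z ≤
      S ^ (p - 1) * ∑' m, (dyadicRieszMass a R m : ℝ≥0∞) * (V m ^ p)⁻¹ *
        ((∫⁻ w in Metric.ball z (R / 2 ^ m), g w) ^ p * v z) := by
    intro z
    -- Jensen with the masses as weights, applied to integrals normalised by the area of the doubled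
    -- disc; the factor `V m ^ p` from the averaging bound then cancels.
    have h := tsum_mul_rpow_le hp (dyadicRieszMass_ne_zero a hR)
      (fun m => (∫⁻ w in Metric.ball z (R / 2 ^ m), g w) / V m)
    have e1 : ∀ m, (dyadicRieszMass a R m : ℝ≥0∞) *
        ((∫⁻ w in Metric.ball z (R / 2 ^ m), g w) / V m) =
        ENNReal.ofReal ((R / 2 ^ (m + 1)) ^ (-a)) *
        ∫⁻ w in Metric.ball z (R / 2 ^ m), g w := by
      intro m
      rw [coe_dyadicRieszMass, mul_assoc, ENNReal.mul_div_cancel (hV0 m) (hVt m)]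
    simp only [e1] at h
    rw [lintegral_dyadicRieszKernel_mul a R hg]
    calc _ ≤ _ := mul_le_mul_left h _
      _ = _ := by
        rw [mul_assoc, ← ENNReal.tsum_mul_right]
        congr 1
        refine tsum_congr fun m => ?_
        rw [ENNReal.div_rpow_of_nonneg _ _ hp0, ENNReal.div_eq_inv_mul]
        ring
  -- No upper bound on `a` is assumed here, so `S = ∞` has to be allowed.
  have hSp : S ^ p ≥ S ^ (p - 1) * S := by
    have hS0 : S ≠ 0 := by
      rw [hS, ne_eq, ENNReal.tsum_eq_zero]
      push Not
      exact ⟨0, by exact_mod_cast dyadicRieszMass_ne_zero a hR 0⟩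
    rcases eq_or_ne S ∞ with hT | hT
    · rw [hT, ENNReal.top_rpow_of_pos (by linarith)]; exact le_top
    · conv_lhs => rw [show p = (p - 1) + 1 by ring, ENNReal.rpow_add _ _ hS0 hT, ENNReal.rpow_one]
  calc ∫⁻ z, (∫⁻ w, dyadicRieszKernel a R (w - z) * g w) ^ p * v z
      ≤ ∫⁻ z, S ^ (p - 1) * ∑' m, (dyadicRieszMass a R m : ℝ≥0∞) * (V m ^ p)⁻¹ *
        ((∫⁻ w in Metric.ball z (R / 2 ^ m), g w) ^ p * v z) := lintegral_mono hpt
    _ = S ^ (p - 1) * ∑' m, (dyadicRieszMass a R m : ℝ≥0∞) * (V m ^ p)⁻¹ *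
        ∫⁻ z, ((∫⁻ w in Metric.ball z (R / 2 ^ m), g w) ^ p * v z) := by
      have hm : ∀ m : ℕ, Measurable fun z =>
          (∫⁻ w in Metric.ball z (R / 2 ^ m), g w) ^ p * (v z : ℝ≥0∞) := fun m =>
        ((hA m).pow_const p).mul hv.coe_nnreal_ennreal
      rw [lintegral_const_mul _ (Measurable.tsum fun m => (hm m).const_mul _),
        lintegral_tsum fun m => ((hm m).const_mul _).aemeasurable]
      congr 1
      exact tsum_congr fun m => lintegral_const_mul _ (hm m)
    _ ≤ S ^ (p - 1) * ∑' m, (dyadicRieszMass a R m : ℝ≥0∞) * (V m ^ p)⁻¹ *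
        (K * V m ^ p * ∫⁻ w, g w ^ p * v w) := by
      gcongr with m
      exact lintegral_setLIntegral_ball_rpow_le hp hv hv0 hK (by positivity) hg
    _ = S ^ (p - 1) * ∑' m, (dyadicRieszMass a R m : ℝ≥0∞) * (K * ∫⁻ w, g w ^ p * v w) := by
      congr 1
      refine tsum_congr fun m => ?_
      have h0 : V m ^ p ≠ 0 := by simp [ENNReal.rpow_eq_zero_iff, hV0, hVt]
      have ht : V m ^ p ≠ ∞ := by simp [ENNReal.rpow_eq_top_iff, hV0, hVt]
      calc _ = (dyadicRieszMass a R m : ℝ≥0∞) * (K * ∫⁻ w, g w ^ p * v w) *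
            (V m ^ p * (V m ^ p)⁻¹) := by ring
        _ = _ := by rw [ENNReal.mul_inv_cancel h0 ht, mul_one]
    _ = S ^ (p - 1) * S * K * ∫⁻ w, g w ^ p * v w := by
      rw [ENNReal.tsum_mul_right]
      ring
    _ ≤ _ := by gcongr

/-! ### Slicing in one coordinate -/

theorem lintegral_eq_lintegral_insertNth {n : ℕ} (j : Fin (n + 1))
    {F : (Fin (n + 1) → ℂ) → ℝ≥0∞} (hF : Measurable F) :
    ∫⁻ z, F z = ∫⁻ zhat : Fin n → ℂ, ∫⁻ w : ℂ, F (Fin.insertNth (α := fun _ => ℂ) j w zhat) := by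
  have e := volume_preserving_piFinSuccAbove (fun _ : Fin (n + 1) => ℂ) j
  rw [← e.symm.lintegral_comp hF]
  exact lintegral_prod_symm' _ (hF.comp (MeasurableEquiv.measurable _))

theorem measurable_insertNth {n : ℕ} (j : Fin (n + 1)) :
    Measurable fun q : ℂ × (Fin n → ℂ) => Fin.insertNth (α := fun _ => ℂ) j q.1 q.2 :=
  (MeasurableEquiv.piFinSuccAbove (fun _ : Fin (n + 1) => ℂ) j).symm.measurable

theorem measurable_insertNth_left {n : ℕ} (j : Fin (n + 1)) (zhat : Fin n → ℂ) :
    Measurable fun w : ℂ => Fin.insertNth (α := fun _ => ℂ) j w zhat :=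
  (measurable_insertNth j).comp measurable_prodMk_right

theorem ae_insertNth_iff {n : ℕ} (j : Fin (n + 1)) {P : (Fin (n + 1) → ℂ) → Prop}
    (hP : MeasurableSet {z | P z}) :
    (∀ᵐ z, P z) ↔ ∀ᵐ zhat : Fin n → ℂ, ∀ᵐ w : ℂ, P (Fin.insertNth (α := fun _ => ℂ) j w zhat) := by
  have h1 := (volume_preserving_piFinSuccAbove (fun _ : Fin (n + 1) => ℂ) j).symm
  rw [← h1.map_eq, ae_map_iff h1.measurable.aemeasurable hP]
  have h2 : MeasurableSet {q : ℂ × (Fin n → ℂ) |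
      P (Fin.insertNth (α := fun _ => ℂ) j q.1 q.2)} := measurable_insertNth j hP
  refine (Measure.ae_prod_iff_ae_ae (μ := (volume : Measure ℂ))
    (ν := (volume : Measure (Fin n → ℂ))) h2).trans ?_
  exact Measure.ae_ae_comm h2

theorem ae_ae_insertNth_of_ae {n : ℕ} (j : Fin (n + 1)) {P : (Fin (n + 1) → ℂ) → Prop}
    (hP : ∀ᵐ z, P z) :
    ∀ᵐ zhat : Fin n → ℂ, ∀ᵐ w : ℂ, P (Fin.insertNth (α := fun _ => ℂ) j w zhat) := by
  -- The exceptional set need not be measurable; a measurable null superset replaces it.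
  obtain ⟨s, hs, hsm, hs0⟩ := mem_ae_iff.1 hP |> exists_measurable_superset_of_null
  have h := (ae_insertNth_iff j (P := fun z => z ∉ s) hsm.compl).1 (by
    rw [ae_iff]; simpa using hs0)
  filter_upwards [h] with zhat hz
  filter_upwards [hz] with w hw
  by_contra hc
  exact hw (hs hc)

/-- The weighted bound for the Riesz potential in the `j`-th variable. -/
theorem lintegral_update_dyadicRieszKernel_rpow_le {n : ℕ} {p : ℝ} (hp : 1 < p)
    {μ : (Fin (n + 1) → ℂ) → ℝ≥0} (hμ : Measurable μ) (hμ0 : ∀ᵐ z, μ z ≠ 0) {K : ℝ≥0∞}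
    (j : Fin (n + 1))
    (hK : ∀ᵐ zhat : Fin n → ℂ, ∀ c r, 0 < r → discApQuantity p (weightSlice μ j zhat) c r ≤ K)
    (a : ℝ) {R : ℝ} (hR : 0 < R) {g : (Fin (n + 1) → ℂ) → ℝ≥0∞} (hg : Measurable g) :
    ∫⁻ z, (∫⁻ w, dyadicRieszKernel a R (w - z j) * g (Function.update z j w)) ^ p * μ z ≤
      (∑' m, (dyadicRieszMass a R m : ℝ≥0∞)) ^ p * K * ∫⁻ z, g z ^ p * μ z := by
  have hT : Measurable fun z : Fin (n + 1) → ℂ =>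
      ∫⁻ w, dyadicRieszKernel a R (w - z j) * g (Function.update z j w) := by
    refine Measurable.lintegral_prod_right'
      (f := fun q : (Fin (n + 1) → ℂ) × ℂ =>
        dyadicRieszKernel a R (q.2 - q.1 j) * g (Function.update q.1 j q.2)) ?_
    exact ((measurable_dyadicRieszKernel a R).comp (by fun_prop)).mul
      (hg.comp measurable_update')
  have hin : Measurable fun zhat : Fin n → ℂ =>
      ∫⁻ w : ℂ, g (Fin.insertNth (α := fun _ => ℂ) j w zhat) ^ p *
        (μ (Fin.insertNth (α := fun _ => ℂ) j w zhat) : ℝ≥0∞) := by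
    refine Measurable.lintegral_prod_left'
      (f := fun q : ℂ × (Fin n → ℂ) => g (Fin.insertNth (α := fun _ => ℂ) j q.1 q.2) ^ p *
        (μ (Fin.insertNth (α := fun _ => ℂ) j q.1 q.2) : ℝ≥0∞)) ?_
    exact ((hg.comp (measurable_insertNth j)).pow_const p).mul
      (hμ.comp (measurable_insertNth j)).coe_nnreal_ennreal
  have hF : Measurable fun z : Fin (n + 1) → ℂ =>
      (∫⁻ w, dyadicRieszKernel a R (w - z j) * g (Function.update z j w)) ^ p * (μ z : ℝ≥0∞) :=
    (hT.pow_const p).mul hμ.coe_nnreal_ennreal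
  have hG : Measurable fun z : Fin (n + 1) → ℂ => g z ^ p * (μ z : ℝ≥0∞) :=
    (hg.pow_const p).mul hμ.coe_nnreal_ennreal
  rw [lintegral_eq_lintegral_insertNth j hF, lintegral_eq_lintegral_insertNth j hG,
    ← lintegral_const_mul _ hin]
  refine lintegral_mono_ae ?_
  filter_upwards [hK, ae_ae_insertNth_of_ae j hμ0] with zhat h1 h2
  have h := lintegral_dyadicRieszKernel_rpow_le hp
    (hμ.comp (measurable_insertNth_left j zhat)) h2 h1 a hR
    (hg.comp (measurable_insertNth_left j zhat))
  simpa only [Fin.insertNth_apply_same, Fin.update_insertNth, Function.comp_def] using h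

/-! ### Iteration over the coordinates -/

/-- The iterated dyadic Riesz potential in the variables belonging to `s`. -/
noncomputable def partialRieszPotential {n : ℕ} (α : Fin n → ℝ) (R : ℝ) (s : Finset (Fin n))
    (g : (Fin n → ℂ) → ℝ≥0∞) (z : Fin n → ℂ) : ℝ≥0∞ :=
  lmarginal (fun _ => volume) s
    (fun ζ => g ζ * ∏ i ∈ s, dyadicRieszKernel (α i) R (ζ i - z i)) z

theorem measurable_mul_prod_dyadicRieszKernel {n : ℕ} (α : Fin n → ℝ) (R : ℝ)
    (s : Finset (Fin n)) {g : (Fin n → ℂ) → ℝ≥0∞} (hg : Measurable g) (z : Fin n → ℂ) :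
    Measurable fun ζ : Fin n → ℂ => g ζ * ∏ i ∈ s, dyadicRieszKernel (α i) R (ζ i - z i) :=
  hg.mul (Finset.measurable_prod _ fun i _ =>
    (measurable_dyadicRieszKernel (α i) R).comp ((measurable_pi_apply i).sub_const _))

/-- Tonelli: as `i ∉ s`, the `i`-th kernel is constant in the variables of `s`, and the kernels of
`s` do not see the change of `z` in coordinate `i`. The new variable is integrated outermost, which
is the form of the one-coordinate bound. -/
theorem partialRieszPotential_insert {n : ℕ} (α : Fin n → ℝ) (R : ℝ) {s : Finset (Fin n)}
    {i : Fin n} (hi : i ∉ s) {g : (Fin n → ℂ) → ℝ≥0∞} (hg : Measurable g) (z : Fin n → ℂ) :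
    partialRieszPotential α R (insert i s) g z =
      ∫⁻ w, dyadicRieszKernel (α i) R (w - z i) *
        partialRieszPotential α R s g (Function.update z i w) := by
  rw [partialRieszPotential,
    lmarginal_insert _ (measurable_mul_prod_dyadicRieszKernel α R _ hg z) hi]
  refine lintegral_congr fun w => ?_
  rw [partialRieszPotential, lmarginal, lmarginal, ← lintegral_const_mul]
  · refine lintegral_congr fun y => ?_
    have h1 : Function.updateFinset (Function.update z i w) s y i = w := by
      simp [Function.updateFinset, hi]
    rw [Finset.prod_insert hi, h1]
    have h2 : ∀ k ∈ s, dyadicRieszKernel (α k) R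
        (Function.updateFinset (Function.update z i w) s y k - z k) =
        dyadicRieszKernel (α k) R
        (Function.updateFinset (Function.update z i w) s y k - Function.update z i w k) := by
      intro k hk
      rw [Function.update_of_ne (ne_of_mem_of_not_mem hk hi) w z]
    rw [Finset.prod_congr rfl h2]
    ring
  · exact (measurable_mul_prod_dyadicRieszKernel α R s hg _).comp measurable_updateFinset

theorem partialRieszPotential_univ {n : ℕ} (α : Fin n → ℝ) (R : ℝ)
    (g : (Fin n → ℂ) → ℝ≥0∞) (z : Fin n → ℂ) :
    partialRieszPotential α R Finset.univ g z =
      ∫⁻ ζ, g ζ * ∏ i, dyadicRieszKernel (α i) R (ζ i - z i) := by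
  rw [partialRieszPotential, lmarginal_univ]
  rfl

theorem measurable_partialRieszPotential {n : ℕ} (α : Fin n → ℝ) (R : ℝ) (s : Finset (Fin n))
    {g : (Fin n → ℂ) → ℝ≥0∞} (hg : Measurable g) :
    Measurable (partialRieszPotential α R s g) := by
  induction s using Finset.induction_on with
  | empty =>
    have : partialRieszPotential α R ∅ g = g := by
      ext z; simp [partialRieszPotential]
    rwa [this]
  | insert i s hi ih =>
    rw [funext (partialRieszPotential_insert α R hi hg)]
    refine Measurable.lintegral_prod_right'
      (f := fun q : (Fin n → ℂ) × ℂ => dyadicRieszKernel (α i) R (q.2 - q.1 i) *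
        partialRieszPotential α R s g (Function.update q.1 i q.2)) ?_
    exact ((measurable_dyadicRieszKernel _ R).comp (by fun_prop)).mul (ih.comp measurable_update')

/-- The one-coordinate bound is applied to the potential in the variables already treated, so the
constants multiply. -/
theorem lintegral_partialRieszPotential_rpow_le {n : ℕ} {p : ℝ} (hp : 1 < p)
    {μ : (Fin (n + 1) → ℂ) → ℝ≥0} (hμ : Measurable μ) (hμ0 : ∀ᵐ z, μ z ≠ 0) {K : ℝ≥0∞}
    (hK : ∀ j : Fin (n + 1), ∀ᵐ zhat : Fin n → ℂ, ∀ c r, 0 < r →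
      discApQuantity p (weightSlice μ j zhat) c r ≤ K)
    (α : Fin (n + 1) → ℝ) {R : ℝ} (hR : 0 < R) (s : Finset (Fin (n + 1)))
    {g : (Fin (n + 1) → ℂ) → ℝ≥0∞} (hg : Measurable g) :
    ∫⁻ z, partialRieszPotential α R s g z ^ p * μ z ≤
      (∏ j ∈ s, (∑' m, (dyadicRieszMass (α j) R m : ℝ≥0∞)) ^ p * K) * ∫⁻ z, g z ^ p * μ z := by
  induction s using Finset.induction_on with
  | empty => simp [partialRieszPotential]
  | insert i s hi ih =>
    simp_rw [partialRieszPotential_insert α R hi hg]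
    refine (lintegral_update_dyadicRieszKernel_rpow_le hp hμ hμ0 i (hK i) (α i) hR
      (measurable_partialRieszPotential α R s hg)).trans ?_
    rw [Finset.prod_insert hi, mul_assoc (_ * K)]
    gcongr

/-! ### Positivity of the weight almost everywhere -/

/-- A one-variable `A_p` weight vanishes almost everywhere or almost nowhere. -/
theorem ae_eq_zero_or_ae_ne_zero_of_discApQuantity_le {p : ℝ} (hp : 1 < p) {v : ℂ → ℝ≥0}
    (hv : Measurable v) {K : ℝ≥0∞} (hKt : K ≠ ∞)
    (hK : ∀ c r, 0 < r → discApQuantity p v c r ≤ K) :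
    (∀ᵐ w, v w = 0) ∨ ∀ᵐ w, v w ≠ 0 := by
  have hball : ∀ N : ℕ, (∀ᵐ w ∂volume.restrict (Metric.ball (0 : ℂ) (N + 1)), v w = 0) ∨
      ∀ᵐ w ∂volume.restrict (Metric.ball (0 : ℂ) (N + 1)), v w ≠ 0 := by
    intro N
    have h := setLIntegral_mul_rpow_le_of_discApQuantity_le hp (v := v) (K := K) (c := 0)
      (r := N + 1) (by positivity) (hK _ _ (by positivity))
    have hfin : K * volume (Metric.ball (0 : ℂ) (N + 1)) ^ p < ∞ :=
      ENNReal.mul_lt_top hKt.lt_top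
        (ENNReal.rpow_lt_top_of_nonneg (by linarith) measure_ball_lt_top.ne)
    -- If the first factor is nonzero, finiteness of the product makes `v^(1/(1-p))` integrable on
    -- the disc. That function is `∞` where `v = 0`, so the zero set is null there.
    by_cases h0 : ∫⁻ w in Metric.ball (0 : ℂ) (N + 1), (v w : ℝ≥0∞) = 0
    · left
      rw [lintegral_eq_zero_iff hv.coe_nnreal_ennreal] at h0
      filter_upwards [h0] with w hw
      simpa using hw
    · right
      have h1 : (∫⁻ w in Metric.ball (0 : ℂ) (N + 1), (v w : ℝ≥0∞) ^ (1 / (1 - p))) ≠ ∞ := by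
        intro hT
        rw [hT, ENNReal.top_rpow_of_pos (by linarith), ENNReal.mul_top h0] at h
        exact absurd (h.trans_lt hfin) (lt_irrefl _)
      filter_upwards [ae_lt_top (by fun_prop) h1] with w hw hw0
      have : 1 / (1 - p) < 0 := div_neg_of_pos_of_neg one_pos (by linarith)
      rw [hw0, ENNReal.coe_zero, ENNReal.zero_rpow_of_neg this] at hw
      exact lt_irrefl _ hw
  have hcov : (⋃ N : ℕ, Metric.ball (0 : ℂ) (N + 1)) = Set.univ := by
    refine Set.eq_univ_of_forall fun w => Set.mem_iUnion.2 ?_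
    obtain ⟨N, hN⟩ := exists_nat_gt ‖w‖
    exact ⟨N, by simpa using by linarith⟩
  by_cases hall : ∀ N : ℕ, ∀ᵐ w ∂volume.restrict (Metric.ball (0 : ℂ) (N + 1)), v w = 0
  · left
    have := (ae_restrict_iUnion_iff (fun N : ℕ => Metric.ball (0 : ℂ) (N + 1)) _).2 hall
    rwa [hcov, Measure.restrict_univ] at this
  · right
    obtain ⟨N₀, hN₀⟩ := not_forall.1 hall
    have hall : ∀ N : ℕ, ∀ᵐ w ∂volume.restrict (Metric.ball (0 : ℂ) (N + 1)), v w ≠ 0 := by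
      intro N
      -- The larger of the two discs contains the disc `N₀`, on which `v` is not almost everywhere
      -- zero, so the first alternative fails on it.
      have h1 : ∀ᵐ w ∂volume.restrict (Metric.ball (0 : ℂ) ((max N N₀ : ℕ) + 1)), v w ≠ 0 := by
        refine (hball (max N N₀)).resolve_left fun h => hN₀ ?_
        refine ae_restrict_of_ae_restrict_of_subset (Metric.ball_subset_ball ?_) h
        gcongr; exact le_max_right _ _
      refine ae_restrict_of_ae_restrict_of_subset (Metric.ball_subset_ball ?_) h1
      gcongr; exact le_max_left _ _
    have := (ae_restrict_iUnion_iff (fun N : ℕ => Metric.ball (0 : ℂ) (N + 1)) _).2 hall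
    rwa [hcov, Measure.restrict_univ] at this

theorem insertNth_add_single {n : ℕ} (j : Fin (n + 1)) (w u : ℂ) (zhat : Fin n → ℂ) :
    (Fin.insertNth (α := fun _ => ℂ) j w zhat : Fin (n + 1) → ℂ) + Pi.single j u =
      Fin.insertNth (α := fun _ => ℂ) j (w + u) zhat := by
  ext k
  refine Fin.succAboveCases j ?_ (fun i => ?_) k <;> simp

/-- A measurable set almost all of whose coordinate slices are null or conull is itself null or
conull. -/
theorem ae_mem_or_ae_notMem_of_slices {n : ℕ} {E : Set (Fin (n + 1) → ℂ)} (hE : MeasurableSet E)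
    (h : ∀ j : Fin (n + 1), ∀ᵐ zhat : Fin n → ℂ,
      (∀ᵐ w : ℂ, Fin.insertNth (α := fun _ => ℂ) j w zhat ∈ E) ∨
      ∀ᵐ w : ℂ, Fin.insertNth (α := fun _ => ℂ) j w zhat ∉ E) :
    (∀ᵐ z, z ∈ E) ∨ ∀ᵐ z, z ∉ E := by
  have hmeas : ∀ u : Fin (n + 1) → ℂ, MeasurableSet {z | z ∈ E ↔ z + u ∈ E} := fun u =>
    hE.iff (measurable_add_const u hE)
  -- On a slice, a null or conull set agrees almost everywhere with its translates.
  have h1 : ∀ (j : Fin (n + 1)) (u : ℂ), ∀ᵐ z, z ∈ E ↔ z + Pi.single j u ∈ E := by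
    intro j u
    rw [ae_insertNth_iff j (hmeas _)]
    have hq := (measurePreserving_add_right (volume : Measure ℂ) u).quasiMeasurePreserving
    filter_upwards [h j] with zhat hz
    simp only [insertNth_add_single]
    rcases hz with hz | hz
    · filter_upwards [hz, hq.ae hz] with w h2 h3
      exact iff_of_true h2 h3
    · filter_upwards [hz, hq.ae hz] with w h2 h3
      exact iff_of_false h2 h3
  have h2 : ∀ (u : Fin (n + 1) → ℂ) (s : Finset (Fin (n + 1))),
      ∀ᵐ z, z ∈ E ↔ z + ∑ j ∈ s, Pi.single j (u j) ∈ E := by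
    intro u s
    induction s using Finset.induction_on with
    | empty => simp
    | insert i s hi ih =>
      have hq := (measurePreserving_add_right (volume : Measure (Fin (n + 1) → ℂ))
        (∑ j ∈ s, Pi.single j (u j))).quasiMeasurePreserving
      filter_upwards [ih, hq.ae (h1 i (u i))] with z h3 h4
      rw [Finset.sum_insert hi, add_comm (Pi.single _ _), ← add_assoc, ← h4]
      exact h3
  have h3 : ∀ u : Fin (n + 1) → ℂ, ∀ᵐ z, z ∈ E ↔ z + u ∈ E := by
    intro u
    have := h2 u Finset.univ
    rwa [Finset.univ_sum_single] at this
  -- Exchanging the quantifiers by Fubini yields one `z` for which `z + u ∈ E` is equivalent to `z ∈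
  -- E` for almost every `u`. Since `z + u` ranges over the whole space, membership of this `z`
  -- decides the alternative.
  have h4 : ∀ᵐ z : Fin (n + 1) → ℂ, ∀ᵐ u : Fin (n + 1) → ℂ, z ∈ E ↔ z + u ∈ E := by
    refine (Measure.ae_ae_comm (p := fun u z : Fin (n + 1) → ℂ => z ∈ E ↔ z + u ∈ E)
      (μ := volume) (ν := volume) ?_).1 (Filter.Eventually.of_forall h3)
    exact (measurable_snd hE).iff ((measurable_snd.add measurable_fst) hE)
  obtain ⟨z, hz⟩ := h4.exists
  have hq := (measurePreserving_add_left (volume : Measure (Fin (n + 1) → ℂ))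
    (-z)).quasiMeasurePreserving
  by_cases hzE : z ∈ E
  · left
    filter_upwards [hq.ae hz] with y hy
    simpa [hzE] using hy
  · right
    filter_upwards [hq.ae hz] with y hy
    simpa [hzE] using hy

/-! ### From the `A_p^*` constant to bounds on slices -/

theorem ae_discApQuantity_le_of_apStarConst_le {n : ℕ} {p : ℝ} {μ : (Fin (n + 1) → ℂ) → ℝ≥0} {K : ℝ≥0∞}
    (hK : apStarConst p μ ≤ K) (j : Fin (n + 1)) :
    ∀ᵐ zhat : Fin n → ℂ, ∀ c r, 0 < r → discApQuantity p (weightSlice μ j zhat) c r ≤ K := by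
  have h := ENNReal.ae_le_essSup (μ := (volume : Measure (Fin n → ℂ))) (fun zhat : Fin n → ℂ =>
      ⨆ (c : ℂ) (r : ℝ) (_ : 0 < r), discApQuantity p (weightSlice μ j zhat) c r)
  filter_upwards [h] with zhat hz c r hr
  calc discApQuantity p (weightSlice μ j zhat) c r
      ≤ ⨆ (c : ℂ) (r : ℝ) (_ : 0 < r), discApQuantity p (weightSlice μ j zhat) c r :=
        le_iSup_of_le c (le_iSup_of_le r (le_iSup_of_le hr le_rfl))
    _ ≤ _ := hz
    _ ≤ apStarConst p μ := le_iSup (fun j : Fin (n + 1) => essSup (fun zhat : Fin n → ℂ =>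
      ⨆ (c : ℂ) (r : ℝ) (_ : 0 < r), discApQuantity p (weightSlice μ j zhat) c r) volume) j
    _ ≤ K := hK

/-- Almost every slice of a null set is null, so the condition survives passing to a Borel
representative of the weight. -/
theorem ae_discApQuantity_le_congr {n : ℕ} {p : ℝ} {μ μ' : (Fin (n + 1) → ℂ) → ℝ≥0} {K : ℝ≥0∞}
    (h : μ =ᵐ[volume] μ') (j : Fin (n + 1))
    (hK : ∀ᵐ zhat : Fin n → ℂ, ∀ c r, 0 < r → discApQuantity p (weightSlice μ j zhat) c r ≤ K) :
    ∀ᵐ zhat : Fin n → ℂ, ∀ c r, 0 < r → discApQuantity p (weightSlice μ' j zhat) c r ≤ K := by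
  filter_upwards [hK, ae_ae_insertNth_of_ae j h] with zhat h1 h2 c r hr
  have h3 : weightSlice μ j zhat =ᵐ[volume] weightSlice μ' j zhat := h2
  convert h1 c r hr using 1
  unfold discApQuantity
  have h4 := ae_restrict_of_ae (s := Metric.ball c r) h3
  congr 1
  · refine laverage_congr ?_
    filter_upwards [h4] with w hw
    rw [hw]
  · congr 1
    refine laverage_congr ?_
    filter_upwards [h4] with w hw
    rw [hw]

theorem ae_ne_zero_of_ae_discApQuantity_le {n : ℕ} {p : ℝ} (hp : 1 < p)
    {μ : (Fin (n + 1) → ℂ) → ℝ≥0} (hμ : Measurable μ) (hμ0 : ¬ μ =ᵐ[volume] 0) {K : ℝ≥0∞}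
    (hKt : K ≠ ∞)
    (hK : ∀ j : Fin (n + 1), ∀ᵐ zhat : Fin n → ℂ, ∀ c r, 0 < r →
      discApQuantity p (weightSlice μ j zhat) c r ≤ K) :
    ∀ᵐ z, μ z ≠ 0 := by
  refine (ae_mem_or_ae_notMem_of_slices (E := {z | μ z = 0}) (hμ (measurableSet_singleton 0))
    fun j => ?_).resolve_left hμ0
  filter_upwards [hK j] with zhat hz
  exact ae_eq_zero_or_ae_ne_zero_of_discApQuantity_le hp
    (hμ.comp (measurable_insertNth_left j zhat)) hKt hz

/-! ### Comparison of the Riesz-type integral with the dyadic potential -/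

/-- Where some `ζ j = z j` the integrand is `0` by the convention for division by zero, in agreement
with `0 ^ (-α j) = 0`. -/
theorem enorm_rieszIntegrand_le {n : ℕ} {α : Fin n → ℝ} (hα : ∀ j, 0 < α j) {R : ℝ}
    (f : (Fin n → ℂ) → ℂ) {z ζ : Fin n → ℂ} (h : ∀ j, ‖ζ j - z j‖ < R) :
    ‖rieszIntegrand α f z ζ‖ₑ ≤ ‖f ζ‖ₑ * ∏ j, dyadicRieszKernel (α j) R (ζ j - z j) := by
  have h1 : ‖rieszIntegrand α f z ζ‖ = ‖f ζ‖ * ∏ j, ‖ζ j - z j‖ ^ (-α j) := by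
    have h0 : 0 ≤ ∏ j, ‖ζ j - z j‖ ^ α j := Finset.prod_nonneg fun j _ => by positivity
    rw [rieszIntegrand, norm_div, Complex.norm_real, Real.norm_of_nonneg h0, div_eq_mul_inv,
      ← Finset.prod_inv_distrib]
    congr 1
    exact Finset.prod_congr rfl fun j _ => (Real.rpow_neg (norm_nonneg _) _).symm
  rw [← ofReal_norm, h1, ENNReal.ofReal_mul (norm_nonneg _), ofReal_norm,
    ENNReal.ofReal_prod_of_nonneg fun j _ => by positivity]
  gcongr with j
  exact rpow_neg_le_dyadicRieszKernel (hα j) (h j)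

theorem setLIntegral_enorm_rieszIntegrand_le {n : ℕ} {α : Fin n → ℝ} (hα : ∀ j, 0 < α j) {R : ℝ}
    {Ω : Set (Fin n → ℂ)} (hΩ : MeasurableSet Ω)
    (hR : ∀ z ∈ Ω, ∀ ζ ∈ Ω, ∀ j, ‖ζ j - z j‖ < R) (f : (Fin n → ℂ) → ℂ) {z : Fin n → ℂ}
    (hz : z ∈ Ω) :
    ∫⁻ ζ in Ω, ‖rieszIntegrand α f z ζ‖ₑ ≤
      partialRieszPotential α R Finset.univ (Ω.indicator fun ζ => ‖f ζ‖ₑ) z := by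
  rw [partialRieszPotential_univ, ← lintegral_indicator hΩ]
  refine lintegral_mono fun ζ => ?_
  by_cases hζ : ζ ∈ Ω
  · simp only [Set.indicator_of_mem hζ]
    exact enorm_rieszIntegrand_le hα f (hR z hz ζ hζ)
  · simp [Set.indicator_of_notMem hζ]

theorem rieszIntegrand_congr_ae {n : ℕ} (α : Fin n → ℝ) {Ω : Set (Fin n → ℂ)}
    {f g : (Fin n → ℂ) → ℂ} (h : f =ᵐ[volume.restrict Ω] g) (z : Fin n → ℂ) :
    rieszIntegrand α f z =ᵐ[volume.restrict Ω] rieszIntegrand α g z := by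
  filter_upwards [h] with ζ hζ
  simp only [rieszIntegrand, hζ]

theorem measurable_uncurry_rieszIntegrand {n : ℕ} (α : Fin n → ℝ) {f : (Fin n → ℂ) → ℂ}
    (hf : Measurable f) :
    Measurable fun q : (Fin n → ℂ) × (Fin n → ℂ) => rieszIntegrand α f q.1 q.2 := by
  unfold rieszIntegrand
  refine (hf.comp measurable_snd).div (Complex.measurable_ofReal.comp ?_)
  exact Finset.measurable_prod _ fun j _ => by fun_prop

theorem stronglyMeasurable_rieszIntegral {n : ℕ} (Ω : Set (Fin n → ℂ)) (α : Fin n → ℝ)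
    {f : (Fin n → ℂ) → ℂ} (hf : Measurable f) : StronglyMeasurable (rieszIntegral Ω α f) :=
  (measurable_uncurry_rieszIntegrand α hf).stronglyMeasurable.integral_prod_right'

theorem lintegral_weightedVolume {n : ℕ} {Ω : Set (Fin n → ℂ)} {μ : (Fin n → ℂ) → ℝ≥0}
    (hμ : Measurable μ) (F : (Fin n → ℂ) → ℝ≥0∞) :
    ∫⁻ z, F z ∂(weightedVolume Ω μ) = ∫⁻ z in Ω, F z * μ z := by
  rw [weightedVolume, lintegral_withDensity_eq_lintegral_mul_non_measurable _
    hμ.coe_nnreal_ennreal (Filter.Eventually.of_forall fun z => ENNReal.coe_lt_top)]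
  simp only [Pi.mul_apply, mul_comm]

theorem weightedVolume_congr {n : ℕ} (Ω : Set (Fin n → ℂ)) {μ μ' : (Fin n → ℂ) → ℝ≥0}
    (h : μ =ᵐ[volume] μ') : weightedVolume Ω μ = weightedVolume Ω μ' := by
  refine withDensity_congr_ae ?_
  filter_upwards [ae_restrict_of_ae h] with z hz
  rw [hz]

/-- Weighted `L^p` estimate for the integral of the absolute values defining the Riesz-type
integral. -/
theorem lintegral_partialRieszPotential_weightedVolume_le {n : ℕ} {p : ℝ} (hp : 1 < p)
    {μ : (Fin (n + 1) → ℂ) → ℝ≥0} (hμ : Measurable μ) (hμ0 : ∀ᵐ z, μ z ≠ 0) {K : ℝ≥0∞}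
    (hK : ∀ j : Fin (n + 1), ∀ᵐ zhat : Fin n → ℂ, ∀ c r, 0 < r →
      discApQuantity p (weightSlice μ j zhat) c r ≤ K)
    (α : Fin (n + 1) → ℝ) {R : ℝ} (hR : 0 < R) {Ω : Set (Fin (n + 1) → ℂ)}
    (hΩ : MeasurableSet Ω) {f : (Fin (n + 1) → ℂ) → ℂ} (hf : Measurable f) :
    ∫⁻ z, partialRieszPotential α R Finset.univ (Ω.indicator fun ζ => ‖f ζ‖ₑ) z ^ p
        ∂(weightedVolume Ω μ) ≤
      (∏ j, (∑' m, (dyadicRieszMass (α j) R m : ℝ≥0∞)) ^ p * K) *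
        ∫⁻ z, ‖f z‖ₑ ^ p ∂(weightedVolume Ω μ) := by
  rw [lintegral_weightedVolume hμ, lintegral_weightedVolume hμ]
  refine (setLIntegral_le_lintegral _ _).trans
    ((lintegral_partialRieszPotential_rpow_le hp hμ hμ0 hK α hR Finset.univ
      (hf.enorm.indicator hΩ)).trans_eq ?_)
  rw [← lintegral_indicator hΩ]
  congr 1
  refine lintegral_congr fun z => ?_
  by_cases hz : z ∈ Ω
  · simp [hz]
  · simp [hz, ENNReal.zero_rpow_of_pos (by linarith : 0 < p)]

theorem exists_pos_forall_norm_sub_lt {n : ℕ} {D : Fin n → Set ℂ}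
    (hD : ∀ j, Bornology.IsBounded (D j)) :
    ∃ R : ℝ, 0 < R ∧ ∀ z ∈ Set.univ.pi D, ∀ ζ ∈ Set.univ.pi D, ∀ j, ‖ζ j - z j‖ < R := by
  obtain ⟨r, hr, hsub⟩ := (Bornology.isBounded_iUnion.2 hD).subset_ball_lt 0 0
  have hb : ∀ z ∈ Set.univ.pi D, ∀ j, ‖z j‖ < r := fun z hz j => by
    simpa using hsub (Set.mem_iUnion.2 ⟨j, hz j (Set.mem_univ j)⟩)
  refine ⟨r + r, by linarith, fun z hz ζ hζ j => ?_⟩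
  exact (norm_sub_le _ _).trans_lt (add_lt_add (hb ζ hζ j) (hb z hz j))

/-! ### The boundedness theorem -/

theorem theorem2p3 {n : ℕ} (D : Fin (n + 1) → Set ℂ)
    (hDopen : ∀ j, IsOpen (D j)) (hDconn : ∀ j, IsConnected (D j))
    (hDbdd : ∀ j, Bornology.IsBounded (D j))
    (α : Fin (n + 1) → ℝ) (hα : ∀ j, 0 < α j ∧ α j < 2)
    (p : ℝ) (hp : 1 < p) (K : ℝ≥0) :
    ∃ C : ℝ≥0, ∀ μ : (Fin (n + 1) → ℂ) → ℝ≥0, MemApStar p μ → apStarConst p μ ≤ K →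
      ∀ f : (Fin (n + 1) → ℂ) → ℂ,
        MemLp f (ENNReal.ofReal p) (weightedVolume (Set.univ.pi D) μ) →
          (∀ᵐ z ∂(volume.restrict (Set.univ.pi D)),
            IntegrableOn (rieszIntegrand α f z) (Set.univ.pi D) volume) ∧
          MemLp (rieszIntegral (Set.univ.pi D) α f) (ENNReal.ofReal p)
            (weightedVolume (Set.univ.pi D) μ) ∧
          eLpNorm (rieszIntegral (Set.univ.pi D) α f) (ENNReal.ofReal p)
              (weightedVolume (Set.univ.pi D) μ) ≤
            C * eLpNorm f (ENNReal.ofReal p) (weightedVolume (Set.univ.pi D) μ) := by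
  have hp0 : 0 < p := by linarith
  obtain ⟨R, hR, hRD⟩ := exists_pos_forall_norm_sub_lt hDbdd
  have hΩ : MeasurableSet (Set.univ.pi D) :=
    (isOpen_set_pi Set.finite_univ fun j _ => hDopen j).measurableSet
  set Ω := Set.univ.pi D
  -- The constant is fixed before the weight is introduced: it involves only `R`, `α`, `p` and `K`.
  set M : ℝ≥0∞ := ∏ j, (∑' m, (dyadicRieszMass (α j) R m : ℝ≥0∞)) ^ p * K with hM
  have hMt : M ≠ ∞ := ENNReal.prod_ne_top fun j _ => ENNReal.mul_ne_top
    (ENNReal.rpow_ne_top_of_nonneg hp0.le (tsum_dyadicRieszMass_ne_top (hα j).2 hR))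
    ENNReal.coe_ne_top
  have hMp : M ^ (1 / p) ≠ ∞ := ENNReal.rpow_ne_top_of_nonneg (by positivity) hMt
  refine ⟨(M ^ (1 / p)).toNNReal, fun μ₀ hμ₀ hK₀ f₀ hf₀ => ?_⟩
  obtain ⟨μ, hμ, hμμ⟩ := hμ₀.aemeasurable
  have hK : ∀ j : Fin (n + 1), ∀ᵐ zhat : Fin n → ℂ, ∀ c r, 0 < r →
      discApQuantity p (weightSlice μ j zhat) c r ≤ K := fun j =>
    ae_discApQuantity_le_congr hμμ j (ae_discApQuantity_le_of_apStarConst_le hK₀ j)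
  have hμ0 : ∀ᵐ z, μ z ≠ 0 := ae_ne_zero_of_ae_discApQuantity_le hp hμ
    (fun h => hμ₀.not_ae_zero (hμμ.trans h)) ENNReal.coe_ne_top hK
  rw [weightedVolume_congr Ω hμμ] at hf₀ ⊢
  -- Positivity of `μ` makes weighted null sets Lebesgue null. Hence changing `f₀` on a weighted
  -- null set alters the Riesz integral at no point `z`, and weighted almost everywhere convergence
  -- is Lebesgue almost everywhere convergence.
  have hac : volume.restrict Ω ≪ weightedVolume Ω μ :=
    withDensity_absolutelyContinuous' hμ.coe_nnreal_ennreal.aemeasurable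
      (by filter_upwards [ae_restrict_of_ae hμ0] with z hz; exact_mod_cast hz)
  have hca : weightedVolume Ω μ ≪ volume.restrict Ω := withDensity_absolutelyContinuous _ _
  obtain ⟨f, hf, hff⟩ := hf₀.aestronglyMeasurable.aemeasurable
  have hff' : f₀ =ᵐ[volume.restrict Ω] f := hac.ae_le hff
  have hint : rieszIntegral Ω α f₀ = rieszIntegral Ω α f :=
    funext fun z => integral_congr_ae (rieszIntegrand_congr_ae α hff' z)
  have hbound := lintegral_partialRieszPotential_weightedVolume_le hp hμ hμ0 hK α hR hΩ hf
  set T := partialRieszPotential α R Finset.univ (Ω.indicator fun ζ => ‖f ζ‖ₑ) with hT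
  have hTm : Measurable T := measurable_partialRieszPotential α R _ (hf.enorm.indicator hΩ)
  have hle : ∀ z ∈ Ω, ∫⁻ ζ in Ω, ‖rieszIntegrand α f z ζ‖ₑ ≤ T z := fun z hz =>
    setLIntegral_enorm_rieszIntegrand_le (fun j => (hα j).1) hΩ hRD f hz
  have hmemΩ : ∀ᵐ z ∂(volume.restrict Ω), z ∈ Ω := ae_restrict_mem hΩ
  have hpe : ENNReal.ofReal p ≠ 0 := by simpa using hp0
  have hnorm : ∀ g : (Fin (n + 1) → ℂ) → ℂ, eLpNorm g (ENNReal.ofReal p) (weightedVolume Ω μ) =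
      (∫⁻ z, ‖g z‖ₑ ^ p ∂(weightedVolume Ω μ)) ^ (1 / p) := fun g => by
    rw [eLpNorm_eq_lintegral_rpow_enorm_toReal hpe ENNReal.ofReal_ne_top,
      ENNReal.toReal_ofReal hp0.le]
  have hnorm_le : eLpNorm (rieszIntegral Ω α f) (ENNReal.ofReal p) (weightedVolume Ω μ) ≤
      ((M ^ (1 / p)).toNNReal : ℝ≥0∞) *
        eLpNorm f (ENNReal.ofReal p) (weightedVolume Ω μ) := by
    rw [hnorm, hnorm, ENNReal.coe_toNNReal hMp, ← ENNReal.mul_rpow_of_nonneg _ _ (by positivity)]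
    refine ENNReal.rpow_le_rpow (le_trans (lintegral_mono_ae ?_) hbound) (by positivity)
    filter_upwards [hca.ae_le hmemΩ] with z hz
    exact ENNReal.rpow_le_rpow ((enorm_integral_le_lintegral_enorm _).trans (hle z hz)) hp0.le
  have hfin : ∫⁻ z, T z ^ p ∂(weightedVolume Ω μ) ≠ ∞ := by
    refine ne_top_of_le_ne_top (ENNReal.mul_ne_top hMt ?_) hbound
    have h := hf₀.eLpNorm_ne_top
    rw [eLpNorm_congr_ae hff, hnorm] at h
    intro hT
    rw [hT, ENNReal.top_rpow_of_pos (by positivity)] at h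
    exact h rfl
  rw [hint, eLpNorm_congr_ae hff]
  refine ⟨?_, ⟨(stronglyMeasurable_rieszIntegral Ω α hf).aestronglyMeasurable, ?_⟩, hnorm_le⟩
  -- The integral of `T ^ p` is finite, so `T` is finite almost everywhere; `T` majorises the
  -- integral of the absolute values.
  · filter_upwards [hac.ae_le (ae_lt_top (hTm.pow_const p) hfin), hmemΩ] with z hz hzΩ
    refine Integrable.congr ⟨?_, ?_⟩ (rieszIntegrand_congr_ae α hff' z).symm
    · exact ((measurable_uncurry_rieszIntegrand α hf).comp
        measurable_prodMk_left).aestronglyMeasurable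
    · exact (hle z hzΩ).trans_lt ((ENNReal.rpow_lt_top_iff_of_pos hp0).1 hz)
  · exact hnorm_le.trans_lt (ENNReal.mul_lt_top ENNReal.coe_lt_top
      (by rw [← eLpNorm_congr_ae hff]; exact hf₀.eLpNorm_lt_top))
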